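/- Call a sequence $(a_n)_{n\ge 0}$ $k$-automatic ($k\ge 2$ an integer) if there is a deterministic finite automaton with output which, on reading any base-$k$ representation of $n$ (least significant digit first, possibly padded with zeros at the most significant end), ends in a state whose output is $a_n$. Say that an irrational real number has a $k$-automatic continued fraction expansion $[a_0,a_1,a_2,\ldots]$ if its regular continued fraction expansion has bounded partial quotients and the sequence $(a_n)_{n\ge 0}$ of partial quotients is $k$-automatic. Let $T(x)=\frac{1}{x-\lfloor x\rfloor}$, so that $T([a_0,a_1,a_2,\ldots])=[a_1,a_2,\ldots]$. Theorem 5. Let $k\ge 2$ and let $x$ be an irrational real number with a $k$-automatic continued fraction expansion. Then $\liminf_{n\to\infty}T^n(x)$ and $\limsup_{n\to\infty}T^n(x)$ are (finite) irrational real numbers, and both have $k$-automatic continued fraction expansions. -/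

import Mathlib

/-- A deterministic finite automaton with output (DFAO) with states `Q`, input alphabet
`{0, …, k - 1}` and outputs in `Δ`. Finiteness of `Q` is imposed where DFAOs are used; the outputs
that occur are then finite in number, so they form a finite output alphabet. -/
structure DFAO (k : ℕ) (Q Δ : Type*) where
  /-- the transition function -/
  step : Q → Fin k → Q
  /-- the initial state -/
  start : Q
  /-- the output function -/
  output : Q → Δ

/-- The state reached from the initial state after reading the word `w` from left to right. -/
def DFAO.eval {k : ℕ} {Q Δ : Type*} (M : DFAO k Q Δ) (w : List (Fin k)) : Q :=
  w.foldl M.step M.start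

/-- The sequence `a` is `k`-automatic: some DFAO with finitely many states, on reading any base-`k`
representation of `n`, least significant digit first and possibly padded with zeros at the most
significant end, reaches a state with output `a n`. (`Nat.ofDigits` takes the least significant
digit first.) -/
def IsAutomatic (k : ℕ) {Δ : Type*} (a : ℕ → Δ) : Prop :=
  ∃ (Q : Type) (_ : Finite Q) (M : DFAO k Q Δ), ∀ w : List (Fin k),
    a (Nat.ofDigits k (w.map Fin.val)) = M.output (M.eval w)

/-- The regular continued fraction expansion of `x` is infinite, equal to `[a 0, a 1, a 2, …]`. -/
def HasContFracExpansion (x : ℝ) (a : ℕ → ℤ) : Prop :=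
  (GenContFract.of x).h = (a 0 : ℝ) ∧
    ∀ n : ℕ, (GenContFract.of x).partDens.get? n = some (a (n + 1) : ℝ)

/-- The continued fraction expansion of `x` is infinite, has bounded partial quotients, and the
sequence of its partial quotients is `k`-automatic. -/
def HasAutomaticContFrac (k : ℕ) (x : ℝ) : Prop :=
  ∃ a : ℕ → ℤ, HasContFracExpansion x a ∧ (∃ B : ℤ, ∀ n, |a n| ≤ B) ∧ IsAutomatic k a

/-- The transformation `T x = 1 / (x - ⌊x⌋)`, which maps `[a₀, a₁, a₂, …]` to `[a₁, a₂, …]`. -/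
noncomputable def contFracShift (x : ℝ) : ℝ :=
  1 / (x - ⌊x⌋)

/-!
Comparing two real numbers amounts to comparing their partial quotients in the alternating
lexicographic order (`FractBound.lt_of_floor_lt`), and on numbers with bounded partial quotients
agreement of long prefixes means closeness (`FractBound.abs_sub_le`). So the lower limit of the
orbit of `x` has as partial quotients the sequence `b` that is least, in the order weighted by
`(-1)ⁿ`, among the limit points of the shifts of the partial quotients `a` of `x`; the upper limit
corresponds to the opposite weights. Such a `b` exists since the partial quotients take finitely
many values (`exists_isLeastLimit`), and it is the expansion of an actual real number since points
of the orbit that share longer and longer prefixes with `b` form a Cauchy sequence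
(`FractBound.exists_limit`).

That `b` is automatic follows from its definability in first-order logic from `a`, the order and
addition (`IsLeastLimit.occurrence_iff`, `IsLeastLimit.finiteKernel`). Closure of automatic
relations under first-order operations is proved for functions of several natural number variables
with finite `k`-kernel. This notion agrees with automaticity for sequences
(`isAutomatic_iff_finiteKernel`) and avoids all questions of padding: quantifying over a variable
only joins finitely many members of the kernel (`FiniteKernel.iSup`). As the lattice of values may
be arbitrary, the same lemma also yields the value `b n` itself, by a union of singletons.
-/

open Filter Topology

/-! ### Functions with finite kernel -/

/-- The vectors with all entries smaller than `k`, in a context `Γ` of natural number variables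
built from `ℕ` by binary products: `box k` is the alphabet of digit vectors in base `k`. -/
class DigitBox (Γ : Type) where
  /-- the set of digit vectors in base `k` -/
  box (k : ℕ) : Set Γ

instance : DigitBox ℕ := ⟨fun k => Set.Iio k⟩

instance {Γ : Type} [DigitBox Γ] : DigitBox (Γ × ℕ) :=
  ⟨fun k => DigitBox.box k ×ˢ Set.Iio k⟩

open DigitBox

/-- A function on a context has a finite `k`-kernel: it lies in a finite family of functions that
is stable under the substitutions `x ↦ k x + r`, for `r` a vector of base-`k` digits. -/
def FiniteKernel (k : ℕ) {Γ : Type} [AddCommMonoid Γ] [DigitBox Γ] {Δ : Type*} (f : Γ → Δ) :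
    Prop :=
  ∃ K : Set (Γ → Δ), K.Finite ∧ f ∈ K ∧ ∀ g ∈ K, ∀ r ∈ box k, (fun x => g (k • x + r)) ∈ K

/-- `v` is one of the variables of the context: reading a digit vector of the context amounts to
reading a digit of `v`. -/
def IsVar (k : ℕ) {Γ : Type} [AddCommMonoid Γ] [DigitBox Γ] (v : Γ → ℕ) : Prop :=
  ∀ x, ∀ r ∈ box k, v r < k ∧ v (k • x + r) = k * v x + v r

section Kernel

variable {k : ℕ} {Γ : Type} [AddCommMonoid Γ] [DigitBox Γ] {Δ Δ' Δ'' : Type*}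

theorem IsVar.id : IsVar k (fun n : ℕ => n) := fun _ _ hr => ⟨hr, rfl⟩

theorem IsVar.snd : IsVar k (fun p : Γ × ℕ => p.2) := fun _ _ hr => ⟨hr.2, rfl⟩

theorem IsVar.weaken {v : Γ → ℕ} (hv : IsVar k v) : IsVar k (fun p : Γ × ℕ => v p.1) :=
  fun x r hr => hv x.1 r.1 hr.1

theorem FiniteKernel.map₂ (h : Δ → Δ' → Δ'') {f : Γ → Δ} {g : Γ → Δ'} (hf : FiniteKernel k f)
    (hg : FiniteKernel k g) : FiniteKernel k (fun x => h (f x) (g x)) := by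
  obtain ⟨K, hK, hfK, hKs⟩ := hf
  obtain ⟨L, hL, hgL, hLs⟩ := hg
  refine ⟨Set.image2 (fun f g x => h (f x) (g x)) K L, hK.image2 _ hL, ⟨f, hfK, g, hgL, rfl⟩, ?_⟩
  rintro _ ⟨f', hf', g', hg', rfl⟩ r hr
  exact ⟨_, hKs f' hf' r hr, _, hLs g' hg' r hr, rfl⟩

theorem FiniteKernel.map (h : Δ → Δ') {f : Γ → Δ} (hf : FiniteKernel k f) :
    FiniteKernel k (fun x => h (f x)) :=
  hf.map₂ (fun a _ => h a) hf

theorem FiniteKernel.and {P Q : Γ → Prop} (hP : FiniteKernel k P) (hQ : FiniteKernel k Q) :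
    FiniteKernel k (fun x => P x ∧ Q x) := hP.map₂ And hQ

theorem FiniteKernel.imp {P Q : Γ → Prop} (hP : FiniteKernel k P) (hQ : FiniteKernel k Q) :
    FiniteKernel k (fun x => P x → Q x) := hP.map₂ (fun p q => p → q) hQ

theorem FiniteKernel.eq {f g : Γ → Δ} (hf : FiniteKernel k f) (hg : FiniteKernel k g) :
    FiniteKernel k (fun x => f x = g x) := hf.map₂ Eq hg

/-- Projection of a variable, in a complete lattice of values; in `Prop` this is existential
quantification. The finite family consists of the joins of the projections of the members of a
finite family for `f`: splitting off the last digit of the bound variable only adds a finite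
join. -/
theorem FiniteKernel.iSup {L : Type*} [CompleteLattice L] {f : Γ × ℕ → L} (hk : 0 < k)
    (hf : FiniteKernel k f) : FiniteKernel k (fun x => ⨆ n, f (x, n)) := by
  obtain ⟨K, hK, hfK, hKs⟩ := hf
  refine ⟨(fun S : Set (Γ × ℕ → L) => fun x => ⨆ g ∈ S, ⨆ n, g (x, n)) '' 𝒫 K,
    hK.finite_subsets.image _, ⟨{f}, by simpa using hfK, by simp⟩, ?_⟩
  rintro _ ⟨S, hS, rfl⟩ r hr
  refine ⟨{g' | ∃ g ∈ S, ∃ s < k, g' = fun p => g (k • p + (r, s))}, ?_, ?_⟩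
  · rintro _ ⟨g, hg, s, hs, rfl⟩
    exact hKs g (hS hg) (r, s) ⟨hr, hs⟩
  · funext x
    apply le_antisymm
    · refine iSup₂_le fun g' hg' => iSup_le fun m => ?_
      obtain ⟨g, hg, s, hs, rfl⟩ := hg'
      exact le_iSup₂_of_le g hg (le_iSup_of_le (k * m + s) (le_of_eq rfl))
    · refine iSup₂_le fun g hg => iSup_le fun n => ?_
      refine le_iSup₂_of_le _ ⟨g, hg, n % k, Nat.mod_lt n hk, rfl⟩
        (le_iSup_of_le (n / k) (le_of_eq ?_))
      change _ = g (k • x + r, k * (n / k) + n % k)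
      rw [Nat.div_add_mod]

theorem FiniteKernel.exists {P : Γ → ℕ → Prop} (hk : 0 < k)
    (hP : FiniteKernel k (fun p : Γ × ℕ => P p.1 p.2)) : FiniteKernel k (fun x => ∃ n, P x n) := by
  simpa only [iSup_Prop_eq] using hP.iSup hk

theorem FiniteKernel.forall {P : Γ → ℕ → Prop} (hk : 0 < k)
    (hP : FiniteKernel k (fun p : Γ × ℕ => P p.1 p.2)) : FiniteKernel k (fun x => ∀ n, P x n) := by
  have h := ((hP.map Not).exists (P := fun x n => ¬ P x n) hk).map Not
  simpa only [not_exists, not_not] using h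

theorem FiniteKernel.lt {v w : Γ → ℕ} (hv : IsVar k v) (hw : IsVar k w) :
    FiniteKernel k (fun x => v x < w x) := by
  refine ⟨{fun x => v x < w x, fun x => v x ≤ w x}, by simp, by simp, ?_⟩
  -- the comparison of the last digits decides between the strict and the weak inequality
  have key (x y r s : ℕ) (hr : r < k) (hs : s < k) :
      k * x + r < k * y + s ↔ if r < s then x ≤ y else x < y := by
    rcases lt_trichotomy x y with h | rfl | h
    · have := Nat.mul_le_mul_left k (Nat.succ_le_of_lt h)
      rw [Nat.mul_succ] at this
      split_ifs <;> simp only [h, h.le, iff_true] <;> omega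
    · split_ifs <;> simp <;> omega
    · have := Nat.mul_le_mul_left k (Nat.succ_le_of_lt h)
      rw [Nat.mul_succ] at this
      split_ifs <;> simp only [h.not_ge, h.not_gt, iff_false] <;> omega
  have hlt (r : Γ) (hr : r ∈ box k) : (fun x => v (k • x + r) < w (k • x + r)) =
      if v r < w r then (fun x => v x ≤ w x) else fun x => v x < w x := by
    funext x
    rw [(hv x r hr).2, (hw x r hr).2, eq_iff_iff, key _ _ _ _ (hv x r hr).1 (hw x r hr).1]
    split_ifs <;> rfl
  have hle (r : Γ) (hr : r ∈ box k) : (fun x => v (k • x + r) ≤ w (k • x + r)) =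
      if w r < v r then (fun x => v x < w x) else fun x => v x ≤ w x := by
    funext x
    rw [(hv x r hr).2, (hw x r hr).2, eq_iff_iff, ← not_lt,
      key _ _ _ _ (hw x r hr).1 (hv x r hr).1]
    split_ifs <;> simp
  rintro g (rfl | rfl) r hr
  · rw [hlt r hr]; split_ifs <;> simp
  · rw [hle r hr]; split_ifs <;> simp

theorem FiniteKernel.le {v w : Γ → ℕ} (hv : IsVar k v) (hw : IsVar k w) :
    FiniteKernel k (fun x => v x ≤ w x) := by
  simpa only [not_lt] using (FiniteKernel.lt hw hv).map Not

/-- Substitution of a sum of two variables. The finite family records a member of the kernel of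
`a` and a carry, which is at most `1`. -/
theorem FiniteKernel.comp_add {a : ℕ → Δ} (ha : FiniteKernel k a) {v w : Γ → ℕ}
    (hv : IsVar k v) (hw : IsVar k w) : FiniteKernel k (fun x => a (v x + w x)) := by
  obtain ⟨K, hK, haK, hKs⟩ := ha
  refine ⟨Set.image2 (fun f c x => f (v x + w x + c)) K (Set.Iic 1), hK.image2 _ (Set.finite_Iic 1),
    ⟨a, haK, 0, by simp, rfl⟩, ?_⟩
  rintro _ ⟨f, hf, c, hc, rfl⟩ r hr
  have h1 := (hv 0 r hr).1
  have h2 := (hw 0 r hr).1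
  have hc' : c ≤ 1 := hc
  refine ⟨_, hKs f hf ((v r + w r + c) % k) (Nat.mod_lt _ (by omega)), (v r + w r + c) / k, ?_, ?_⟩
  · change _ ≤ 1
    rw [← Nat.lt_succ_iff, Nat.div_lt_iff_lt_mul (by omega)]
    omega
  · funext x
    change f (k * _ + _) = f _
    rw [(hv x r hr).2, (hw x r hr).2]
    congr 1
    rw [mul_add, add_assoc, Nat.div_add_mod]
    ring

theorem FiniteKernel.comp_var {a : ℕ → Δ} (ha : FiniteKernel k a) {v : Γ → ℕ}
    (hv : IsVar k v) : FiniteKernel k (fun x => a (v x)) := by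
  obtain ⟨K, hK, haK, hKs⟩ := ha
  refine ⟨(fun f x => f (v x)) '' K, hK.image _, ⟨a, haK, rfl⟩, ?_⟩
  rintro _ ⟨f, hf, rfl⟩ r hr
  refine ⟨_, hKs f hf (v r) (hv 0 r hr).1, ?_⟩
  funext x
  exact congrArg f (hv x r hr).2.symm

theorem FiniteKernel.mod_two : FiniteKernel k (fun n : ℕ => n % 2) := by
  refine ⟨Set.image2 (fun p q n => (p * n + q) % 2) (Set.Iio 2) (Set.Iio 2),
    (Set.finite_Iio 2).image2 _ (Set.finite_Iio 2), ⟨1, by simp, 0, by simp, by simp⟩, ?_⟩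
  rintro _ ⟨p, -, q, -, rfl⟩ r -
  refine ⟨p * k % 2, Nat.mod_lt _ two_pos, (p * r + q) % 2, Nat.mod_lt _ two_pos, ?_⟩
  funext n
  have h : p * (k * n + r) + q = p * k * n + (p * r + q) := by ring
  change _ = (p * (k * n + r) + q) % 2
  rw [h]
  exact ((Nat.mod_modEq _ 2).mul_right n).add (Nat.mod_modEq _ 2)

/-- Automaticity by finite automata coincides with finiteness of the kernel: the states correspond
to the members of the finite family. -/
theorem isAutomatic_iff_finiteKernel {Δ : Type} (hk : 2 ≤ k) (a : ℕ → Δ) :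
    IsAutomatic k a ↔ FiniteKernel k a := by
  constructor
  · rintro ⟨Q, hQ, M, hM⟩
    -- the members of the kernel are the subsequences read off from the reachable states
    let F : Q → ℕ → Δ := fun q n => M.output
      (((Nat.digits k n).attach.map
        fun d => (⟨d.1, Nat.digits_lt_base (by omega) d.2⟩ : Fin k)).foldl M.step q)
    have hF (w : List (Fin k)) (n : ℕ) :
        F (M.eval w) n = a (k ^ w.length * n + Nat.ofDigits k (w.map Fin.val)) := by
      have := hM (w ++ (Nat.digits k n).attach.map
        fun d => (⟨d.1, Nat.digits_lt_base (by omega) d.2⟩ : Fin k))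
      rw [DFAO.eval, List.foldl_append] at this
      change _ = F (M.eval w) n at this
      rw [← this, List.map_append, List.map_map, Nat.ofDigits_append, List.length_map]
      have h2 : List.map (Fin.val ∘ fun d : {x // x ∈ Nat.digits k n} =>
          (⟨d.1, Nat.digits_lt_base (by omega) d.2⟩ : Fin k)) (Nat.digits k n).attach =
          Nat.digits k n := by
        exact List.attach_map_subtype_val _
      rw [h2, Nat.ofDigits_digits, add_comm]
    refine ⟨Set.range (fun w : List (Fin k) => F (M.eval w)), ?_, ⟨[], ?_⟩, ?_⟩
    · exact (Set.finite_range F).subset (by rintro _ ⟨w, rfl⟩; exact ⟨_, rfl⟩)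
    · funext n
      simpa using hF [] n
    · rintro _ ⟨w, rfl⟩ r hr
      refine ⟨w ++ [⟨r, hr⟩], ?_⟩
      funext n
      simp only [hF, List.map_append, Nat.ofDigits_append, List.length_append, List.length_map]
      simp only [List.length_cons, List.length_nil, List.map_cons, List.map_nil,
        Nat.ofDigits_singleton, smul_eq_mul]
      congr 1
      ring
  · rintro ⟨K, hK, haK, hKs⟩
    let M : DFAO k K Δ := ⟨fun g r => ⟨_, hKs g.1 g.2 r.1 r.2⟩, ⟨a, haK⟩, fun g => g.1 0⟩
    refine ⟨K, hK.to_subtype, M, fun w => ?_⟩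
    have key (w : List (Fin k)) (g : K) :
        (w.foldl M.step g).1 0 = g.1 (Nat.ofDigits k (w.map Fin.val)) := by
      induction w generalizing g with
      | nil => simp
      | cons r w ih =>
        rw [List.foldl_cons, ih, List.map_cons, Nat.ofDigits_cons, add_comm]
        rfl
    exact (key w ⟨a, haK⟩).symm

end Kernel

/-! ### Least limit points of the shifts of a sequence -/

/-- `b` is the least limit point of the shifts of `a`, in the lexicographic order that compares the
`n`-th entries after multiplication by `ε n`: every prefix of `b` occurs in `a` at arbitrarily late
positions, and only finitely many occurrences of a prefix continue by a smaller entry. -/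
def IsLeastLimit (ε a b : ℕ → ℤ) : Prop :=
  (∀ n, ∃ᶠ i in atTop, ∀ d < n, a (i + d) = b d) ∧
    ∀ n, ∀ᶠ i in atTop, (∀ d < n, a (i + d) = b d) → ε n * b n ≤ ε n * a (i + n)

theorem exists_isLeastLimit (ε : ℕ → ℤ) {a : ℕ → ℤ} {B : ℤ} (ha : ∀ n, |a n| ≤ B) :
    ∃ b, IsLeastLimit ε a b := by
  have step : ∀ (n : ℕ) (S : Set ℕ), ∃ c : ℤ, (∃ᶠ i in atTop, i ∈ S) →
      (∃ᶠ i in atTop, i ∈ S ∧ a (i + n) = c) ∧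
        ∀ᶠ i in atTop, i ∈ S → ε n * c ≤ ε n * a (i + n) := by
    intro n S
    by_cases hS : ∃ᶠ i in atTop, i ∈ S
    swap
    · exact ⟨0, fun h => absurd h hS⟩
    classical
    have hmem (i : ℕ) : a (i + n) ∈ Finset.Icc (-B) B := Finset.mem_Icc.2 (abs_le.1 (ha _))
    obtain ⟨c, hc, hmin⟩ := Finset.exists_min_image
      ((Finset.Icc (-B) B).filter fun c => ∃ᶠ i in atTop, i ∈ S ∧ a (i + n) = c)
      (fun c => ε n * c) (by
        by_contra hne
        rw [Finset.not_nonempty_iff_eq_empty, Finset.filter_eq_empty_iff] at hne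
        have : ∀ᶠ i in atTop, ∀ c ∈ Finset.Icc (-B) B, ¬ (i ∈ S ∧ a (i + n) = c) :=
          (eventually_all_finset _).2 fun c hc => not_frequently.1 (hne hc)
        exact hS (this.mono fun i hi hiS => hi _ (hmem i) ⟨hiS, rfl⟩))
    refine ⟨c, fun _ => ⟨(Finset.mem_filter.1 hc).2, ?_⟩⟩
    have : ∀ᶠ i in atTop, ∀ c' ∈ Finset.Icc (-B) B, ε n * c' < ε n * c →
        ¬ (i ∈ S ∧ a (i + n) = c') := by
      refine (eventually_all_finset _).2 fun c' hc' => eventually_imp_distrib_left.2 fun hlt => ?_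
      refine not_frequently.1 fun hf => ?_
      exact (hmin c' (Finset.mem_filter.2 ⟨hc', hf⟩)).not_gt hlt
    exact this.mono fun i hi hiS => not_lt.1 fun hlt => hi _ (hmem i) hlt ⟨hiS, rfl⟩
  choose c hc using step
  -- `S n` collects the positions of `a` where the first `n` entries of `b` occur
  let S : ℕ → Set ℕ := fun n => Nat.rec Set.univ (fun n S => {i | i ∈ S ∧ a (i + n) = c n S}) n
  have hS (n : ℕ) : ∀ i, i ∈ S n ↔ ∀ d < n, a (i + d) = c d (S d) := by
    induction n with
    | zero => intro i; simp [S]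
    | succ n ih =>
      intro i
      rw [Nat.forall_lt_succ_right, ← ih i]
      rfl
  have hfreq (n : ℕ) : ∃ᶠ i in atTop, i ∈ S n := by
    induction n with
    | zero => exact Frequently.of_forall fun i => trivial
    | succ n ih => exact (hc n (S n) ih).1
  refine ⟨fun n => c n (S n), fun n => ?_, fun n => ?_⟩
  · exact (hfreq n).mono fun i hi => (hS n i).1 hi
  · exact (hc n (S n) (hfreq n)).2.mono fun i hi h => hi ((hS n i).2 h)

/-- First-order description of the positions where the prefix of length `n + 1` of the least limit
occurs: the factor of `a` at such a position occurs at arbitrarily late positions, and late factors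
do not precede it. -/
theorem IsLeastLimit.occurrence_iff {ε a b : ℕ → ℤ} (hε : ∀ n, ε n ≠ 0)
    (hb : IsLeastLimit ε a b) (n i : ℕ) :
    (∀ d, d ≤ n → a (i + d) = b d) ↔
      (∀ N, ∃ j, N ≤ j ∧ ∀ d, d ≤ n → a (i + d) = a (j + d)) ∧
      (∃ N, ∀ j, N ≤ j → ∀ d, d ≤ n → (∀ e, e < d → a (j + e) = a (i + e)) →
        ε d * a (i + d) ≤ ε d * a (j + d)) := by
  obtain ⟨h1, h2⟩ := hb
  constructor
  · intro h
    constructor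
    · intro N
      obtain ⟨j, hj, hj'⟩ := (frequently_atTop.1 (h1 (n + 1))) N
      exact ⟨j, hj, fun d hd => (h d hd).trans (hj' d (by omega)).symm⟩
    · have : ∀ᶠ j in atTop, ∀ d ∈ Finset.range (n + 1), (∀ e < d, a (j + e) = b e) →
          ε d * b d ≤ ε d * a (j + d) := (eventually_all_finset _).2 fun d _ => h2 d
      obtain ⟨N, hN⟩ := eventually_atTop.1 this
      refine ⟨N, fun j hj d hd he => ?_⟩
      rw [h d hd]
      exact hN j hj d (Finset.mem_range.2 (by omega)) fun e hed => by
        rw [he e hed, h e (by omega)]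
  · rintro ⟨hrec, N, hN⟩ d
    induction d using Nat.strong_induction_on with
    | _ d ih =>
      intro hd
      apply mul_left_cancel₀ (hε d)
      apply le_antisymm
      · obtain ⟨j, hj, hj'⟩ := (frequently_atTop.1 (h1 (d + 1))) N
        rw [← hj' d (by omega)]
        refine hN j hj d hd fun e he => ?_
        rw [hj' e (by omega), ih e he (by omega)]
      · obtain ⟨N', hN'⟩ := eventually_atTop.1 (h2 d)
        obtain ⟨j, hj, hj'⟩ := hrec N'
        rw [hj' d hd]
        refine hN' j hj fun e he => ?_
        rw [← hj' e (by omega), ih e he (by omega)]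

/-- The least limit of an automatic sequence is automatic, since it is definable in first-order
logic from the sequence, the order and addition. -/
theorem IsLeastLimit.finiteKernel {k : ℕ} (hk : 0 < k) {ε a b : ℕ → ℤ} (hε : ∀ n, ε n ≠ 0)
    (hεk : FiniteKernel k ε) (ha : FiniteKernel k a) (hb : IsLeastLimit ε a b) :
    FiniteKernel k b := by
  have h1 : FiniteKernel k (fun p : ℕ × ℕ => ∀ N, ∃ j, N ≤ j ∧ ∀ d, d ≤ p.1 →
      a (p.2 + d) = a (j + d)) := by
    refine .forall hk (.exists hk (.and (.le IsVar.snd.weaken .snd) (.forall hk (.imp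
      (.le .snd IsVar.id.weaken.weaken.weaken.weaken) (.eq
        (ha.comp_add IsVar.snd.weaken.weaken.weaken .snd) (ha.comp_add IsVar.snd.weaken .snd))))))
  have h2 : FiniteKernel k (fun p : ℕ × ℕ => ∃ N, ∀ j, N ≤ j → ∀ d, d ≤ p.1 →
      (∀ e, e < d → a (j + e) = a (p.2 + e)) → ε d * a (p.2 + d) ≤ ε d * a (j + d)) := by
    refine .exists hk (.forall hk (.imp (.le IsVar.snd.weaken .snd) (.forall hk (.imp
      (.le .snd IsVar.id.weaken.weaken.weaken.weaken) (.imp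
        (.forall hk (.imp (.lt .snd IsVar.snd.weaken) (.eq
          (ha.comp_add IsVar.snd.weaken.weaken .snd)
          (ha.comp_add IsVar.snd.weaken.weaken.weaken.weaken .snd))))
        (.map₂ (· ≤ ·)
          (.map₂ (· * ·) (hεk.comp_var .snd) (ha.comp_add IsVar.snd.weaken.weaken.weaken .snd))
          (.map₂ (· * ·) (hεk.comp_var .snd) (ha.comp_add IsVar.snd.weaken .snd))))))))
  -- the set of all entries `a (i + n)` over the occurrences `i` of the prefix is `{b n}`
  have h3 := ((h1.and h2).map₂ (fun (P : Prop) (c : ℤ) => {m | P ∧ m = c})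
    (ha.comp_add IsVar.snd IsVar.id.weaken)).iSup hk
  convert h3.map sInf using 2 with n
  rw [← csInf_singleton (b n)]
  congr 1
  ext m
  simp only [← hb.occurrence_iff hε, Set.iSup_eq_iUnion, Set.mem_iUnion, Set.mem_ofPred_eq,
    Set.mem_singleton_iff]
  constructor
  · rintro rfl
    obtain ⟨i, hi⟩ := (hb.1 (n + 1)).exists
    exact ⟨i, fun d hd => hi d (by omega), (hi n (by omega)).symm⟩
  · rintro ⟨i, hi, rfl⟩
    exact hi n le_rfl

/-! ### The continued fraction shift -/

/-- All fractional parts along the orbit of `u` under `contFracShift` are at least `δ`. For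
`δ > 0` this means that the expansion of `u` is infinite with bounded partial quotients. -/
def FractBound (δ u : ℝ) : Prop :=
  ∀ n : ℕ, δ ≤ Int.fract (contFracShift^[n] u)

theorem eq_floor_add_inv_contFracShift (u : ℝ) : u = ⌊u⌋ + (contFracShift u)⁻¹ := by
  rw [contFracShift, one_div, inv_inv, Int.self_sub_floor, Int.floor_add_fract]

namespace FractBound

variable {δ u v : ℝ}

theorem fract_ne_zero (hδ : 0 < δ) (hu : FractBound δ u) (n : ℕ) :
    Int.fract (contFracShift^[n] u) ≠ 0 := (hδ.trans_le (hu n)).ne'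

theorem iterate (hu : FractBound δ u) (m : ℕ) : FractBound δ (contFracShift^[m] u) := fun n => by
  rw [← Function.iterate_add_apply]
  exact hu _

theorem shift (hu : FractBound δ u) : FractBound δ (contFracShift u) := hu.iterate 1

theorem one_add_le_shift (hδ : 0 < δ) (hu : FractBound δ u) : 1 + δ ≤ contFracShift u := by
  have h0 : 0 < Int.fract u := hδ.trans_le (hu 0)
  have h1 : 1 ≤ contFracShift u := by
    rw [contFracShift, Int.self_sub_floor, le_div_iff₀ h0, one_mul]
    exact (Int.fract_lt_one u).le
  have h2 : (1 : ℝ) ≤ ⌊contFracShift u⌋ := by exact_mod_cast Int.le_floor.2 (by simpa using h1)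
  rw [← Int.floor_add_fract (contFracShift u)]
  exact add_le_add h2 (hu 1)

theorem fract_le (hδ : 0 < δ) (hu : FractBound δ u) : Int.fract u ≤ (1 + δ)⁻¹ := by
  have h : Int.fract u = (contFracShift u)⁻¹ := by
    rw [contFracShift, one_div, inv_inv, Int.self_sub_floor]
  rw [h]
  exact inv_anti₀ (by linarith) (hu.one_add_le_shift hδ)

theorem sub_eq (hδ : 0 < δ) (hu : FractBound δ u) (hv : FractBound δ v) (h : ⌊u⌋ = ⌊v⌋) :
    u - v = (contFracShift v - contFracShift u) / (contFracShift u * contFracShift v) := by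
  have h1 := hu.one_add_le_shift hδ
  have h2 := hv.one_add_le_shift hδ
  have h3 : contFracShift u ≠ 0 := by linarith
  have h4 : contFracShift v ≠ 0 := by linarith
  have h5 := eq_floor_add_inv_contFracShift u
  have h6 := eq_floor_add_inv_contFracShift v
  have : u - v = (contFracShift u)⁻¹ - (contFracShift v)⁻¹ := by
    rw [h] at h5
    linarith
  rw [this, inv_sub_inv h3 h4]

/-- Reals whose first partial quotients agree are exponentially close. -/
theorem abs_sub_le (hδ : 0 < δ) (hu : FractBound δ u) (hv : FractBound δ v) (n : ℕ)
    (h : ∀ d ≤ n, ⌊contFracShift^[d] u⌋ = ⌊contFracShift^[d] v⌋) :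
    |u - v| ≤ (((1 + δ) ^ 2)⁻¹) ^ n := by
  induction n generalizing u v with
  | zero => simpa using (Int.abs_sub_lt_one_of_floor_eq_floor (h 0 le_rfl)).le
  | succ n ih =>
    have h1 := hu.one_add_le_shift hδ
    have h2 := hv.one_add_le_shift hδ
    have h3 := ih hu.shift hv.shift fun d hd => h (d + 1) (by omega)
    have h4 : (1 + δ) ^ 2 ≤ contFracShift u * contFracShift v := by
      rw [sq]
      exact mul_le_mul h1 h2 (by linarith) (by linarith)
    rw [sub_eq hδ hu hv (h 0 (Nat.zero_le _)), abs_div, abs_sub_comm, pow_succ, div_eq_mul_inv]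
    refine mul_le_mul h3 ?_ (by positivity) (by positivity)
    exact inv_anti₀ (by positivity) (h4.trans (le_abs_self _))

/-- The first partial quotients that differ determine the order of two reals, increasingly at even
and decreasingly at odd positions; the sign of `s` reverses both. -/
theorem lt_of_floor_lt (hδ : 0 < δ) (hu : FractBound δ u) (hv : FractBound δ v) (s : ℤ) (d : ℕ)
    (h : ∀ e < d, ⌊contFracShift^[e] u⌋ = ⌊contFracShift^[e] v⌋)
    (hd : s * (-1) ^ d * ⌊contFracShift^[d] u⌋ < s * (-1) ^ d * ⌊contFracShift^[d] v⌋) :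
    (s : ℝ) * u < s * v := by
  induction d generalizing u v s with
  | zero =>
    simp only [pow_zero, mul_one, Function.iterate_zero, id_eq] at hd
    rcases lt_trichotomy s 0 with hs | rfl | hs
    · have h1 := Int.floor_mono.reflect_lt ((mul_lt_mul_left_of_neg hs).1 hd)
      exact mul_lt_mul_of_neg_left h1 (by exact_mod_cast hs)
    · simp at hd
    · have h1 := Int.floor_mono.reflect_lt ((mul_lt_mul_iff_right₀ hs).1 hd)
      exact mul_lt_mul_of_pos_left h1 (by exact_mod_cast hs)
  | succ d ih =>
    have h1 := hu.one_add_le_shift hδ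
    have h2 := hv.one_add_le_shift hδ
    have h3 := ih hu.shift hv.shift (-s) (fun e he => h (e + 1) (by omega)) (by
      simpa only [pow_succ, mul_neg, mul_one, neg_mul, Function.iterate_succ_apply] using hd)
    have h4 := sub_eq hδ hv hu (h 0 (Nat.zero_lt_succ _)).symm
    have h5 : 0 < (s : ℝ) * (v - u) := by
      rw [h4, ← mul_div_assoc]
      push_cast at h3
      exact div_pos (by linarith) (mul_pos (by linarith) (by linarith))
    linarith

end FractBound

theorem hasContFracExpansion_iff {u : ℝ} (hu : ∀ n : ℕ, Int.fract (contFracShift^[n] u) ≠ 0)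
    (a : ℕ → ℤ) : HasContFracExpansion u a ↔ ∀ n, ⌊contFracShift^[n] u⌋ = a n := by
  have key (n : ℕ) : ∀ v : ℝ, (∀ m : ℕ, Int.fract (contFracShift^[m] v) ≠ 0) →
      (GenContFract.of v).s.get? n = some ⟨1, (⌊contFracShift^[n + 1] v⌋ : ℝ)⟩ := by
    induction n with
    | zero =>
      intro v hv
      have := GenContFract.of_s_head (hv 0)
      rw [Stream'.Seq.head] at this
      simpa [contFracShift] using this
    | succ n ih =>
      intro v hv
      rw [GenContFract.of_s_succ]
      have h : (Int.fract v)⁻¹ = contFracShift v := by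
        rw [contFracShift, one_div, Int.self_sub_floor]
      rw [h, ih _ fun m => hv (m + 1)]
      rfl
  have hden (n : ℕ) : (GenContFract.of u).partDens.get? n =
      some (⌊contFracShift^[n + 1] u⌋ : ℝ) := GenContFract.partDen_eq_s_b (key n u hu)
  simp only [HasContFracExpansion, GenContFract.of_h_eq_floor, hden, Option.some.injEq,
    Int.cast_inj]
  constructor
  · rintro ⟨h0, h1⟩ (_ | n)
    · exact h0
    · exact h1 n
  · exact fun h => ⟨h 0, fun n => h (n + 1)⟩

theorem Irrational.contFracShift {x : ℝ} (hx : Irrational x) : Irrational (contFracShift x) := by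
  rw [_root_.contFracShift, one_div]
  exact (hx.sub_intCast _).inv

theorem Irrational.iterate_contFracShift {x : ℝ} (hx : Irrational x) (n : ℕ) :
    Irrational (_root_.contFracShift^[n] x) := by
  induction n with
  | zero => exact hx
  | succ n ih =>
    rw [Function.iterate_succ_apply']
    exact ih.contFracShift

theorem Irrational.fract_iterate_ne_zero {x : ℝ} (hx : Irrational x) (n : ℕ) :
    Int.fract (_root_.contFracShift^[n] x) ≠ 0 := fun h => by
  obtain ⟨m, hm⟩ := Int.fract_eq_zero_iff.1 h
  exact (hx.iterate_contFracShift n).ne_int m hm.symm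

/-- Bounded partial quotients bound the fractional parts away from zero. -/
theorem fractBound_of_floor_le {x : ℝ} (hx : ∀ n : ℕ, Int.fract (contFracShift^[n] x) ≠ 0) {B : ℤ}
    (hB : ∀ n : ℕ, |⌊contFracShift^[n] x⌋| ≤ B) : FractBound ((B + 1 : ℝ)⁻¹) x := by
  intro n
  have h0 : 0 < Int.fract (contFracShift^[n] x) := (Int.fract_nonneg _).lt_of_ne' (hx n)
  have h1 : (⌊contFracShift^[n + 1] x⌋ : ℝ) ≤ B := by exact_mod_cast (le_abs_self _).trans (hB _)
  have h2 : contFracShift^[n + 1] x ≤ B + 1 := by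
    linarith [Int.lt_floor_add_one (contFracShift^[n + 1] x)]
  rw [Function.iterate_succ_apply', contFracShift, Int.self_sub_floor] at h2
  rw [← inv_inv (Int.fract _), ← one_div (Int.fract _)]
  exact inv_anti₀ (by positivity) h2

/-! ### Extremal limit points of orbits -/

/-- A sequence of partial quotients all of whose prefixes occur along an orbit with fractional
parts at least `δ` is the expansion of some real number, the limit of points of the orbit. -/
theorem FractBound.exists_limit {δ x : ℝ} (hδ : 0 < δ) (hx : FractBound δ x) {b : ℕ → ℤ}
    (hb : ∀ n, ∃ i, ∀ d < n, ⌊contFracShift^[i + d] x⌋ = b d) :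
    ∃ y, FractBound δ y ∧ ∀ n, ⌊contFracShift^[n] y⌋ = b n := by
  choose i hi using fun n => hb (n + 1)
  set z : ℕ → ℝ := fun n => contFracShift^[i n] x with hz
  have hzb (n d : ℕ) (hd : d ≤ n) : ⌊contFracShift^[d] (z n)⌋ = b d := by
    rw [hz, ← Function.iterate_add_apply, add_comm]
    exact hi n d (by omega)
  have hzδ (n : ℕ) : FractBound δ (z n) := hx.iterate _
  have hρ : ((1 + δ) ^ 2)⁻¹ < 1 := inv_lt_one_of_one_lt₀ (by nlinarith)
  have hcauchy : CauchySeq z := by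
    refine cauchySeq_of_le_geometric _ 1 hρ fun n => ?_
    rw [Real.dist_eq, one_mul]
    refine abs_sub_le hδ (hzδ _) (hzδ _) n fun d hd => ?_
    rw [hzb _ _ hd, hzb _ _ (by omega)]
  obtain ⟨y, hy⟩ := cauchySeq_tendsto_of_complete hcauchy
  -- the iterates of `z n` stay at a definite distance from the integers, where the shift jumps
  have hIcc (d : ℕ) : Tendsto (fun n => contFracShift^[d] (z n)) atTop (𝓝 (contFracShift^[d] y)) →
      contFracShift^[d] y - b d ∈ Set.Icc δ (1 + δ)⁻¹ := fun h => by
    refine isClosed_Icc.mem_of_tendsto (h.sub_const (b d : ℝ)) ?_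
    filter_upwards [eventually_ge_atTop d] with n hn
    rw [← hzb n d hn, Int.self_sub_floor]
    exact ⟨hzδ n d, ((hzδ n).iterate d).fract_le hδ⟩
  have hlim (d : ℕ) :
      Tendsto (fun n => contFracShift^[d] (z n)) atTop (𝓝 (contFracShift^[d] y)) ∧
        ⌊contFracShift^[d] y⌋ = b d := by
    have hfloor (d : ℕ) (h : contFracShift^[d] y - b d ∈ Set.Icc δ (1 + δ)⁻¹) :
        ⌊contFracShift^[d] y⌋ = b d := by
      have : (1 + δ)⁻¹ < 1 := inv_lt_one_of_one_lt₀ (by linarith)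
      exact Int.floor_eq_iff.2 ⟨by linarith [h.1], by linarith [h.2]⟩
    induction d with
    | zero => exact ⟨hy, hfloor 0 (hIcc 0 hy)⟩
    | succ d ih =>
      have h : Tendsto (fun n => contFracShift^[d + 1] (z n)) atTop
          (𝓝 (contFracShift^[d + 1] y)) := by
        simp only [Function.iterate_succ_apply']
        have hne : contFracShift^[d] y - b d ≠ 0 := (hδ.trans_le (hIcc d ih.1).1).ne'
        have := (tendsto_const_nhds (x := (1 : ℝ))).div (ih.1.sub_const (b d : ℝ)) hne
        rw [contFracShift, ih.2]
        refine this.congr' ?_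
        filter_upwards [eventually_ge_atTop d] with n hn
        rw [contFracShift, hzb n d hn]
        rfl
      exact ⟨h, hfloor _ (hIcc _ h)⟩
  refine ⟨y, fun n => ?_, fun n => (hlim n).2⟩
  rw [← Int.self_sub_floor, (hlim n).2]
  exact (hIcc n (hlim n).1).1

/-- The least limit of the partial quotients for the signs `s (-1)ⁿ` is the expansion of a limit
point of the orbit, which is the lower limit when `s = 1` and the upper limit when `s = -1`. -/
theorem FractBound.exists_extremal_limit {δ x : ℝ} (hδ : 0 < δ) (hx : FractBound δ x) {s : ℤ}
    (hs : |s| = 1) {b : ℕ → ℤ}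
    (hb : IsLeastLimit (fun n => s * (-1) ^ n) (fun n => ⌊contFracShift^[n] x⌋) b) :
    ∃ y, FractBound δ y ∧ (∀ n, ⌊contFracShift^[n] y⌋ = b n) ∧
      ∀ η > 0, (∃ᶠ i in atTop, |contFracShift^[i] x - y| < η) ∧
        ∀ᶠ i in atTop, s * y - η < s * contFracShift^[i] x := by
  obtain ⟨y, hy, hyb⟩ := hx.exists_limit hδ fun n => (hb.1 n).exists
  refine ⟨y, hy, hyb, fun η hη => ?_⟩
  have hρ : ((1 + δ) ^ 2)⁻¹ < 1 := inv_lt_one_of_one_lt₀ (by nlinarith)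
  obtain ⟨n, hn⟩ := exists_pow_lt_of_lt_one hη hρ
  have hclose (i : ℕ) (hi : ∀ d < n + 1, ⌊contFracShift^[i + d] x⌋ = b d) :
      |contFracShift^[i] x - y| < η := by
    refine (abs_sub_le hδ (hx.iterate i) hy n fun d hd => ?_).trans_lt hn
    rw [← Function.iterate_add_apply, add_comm, hi d (by omega), hyb]
  refine ⟨(hb.1 (n + 1)).mono hclose, ?_⟩
  have hev := (eventually_all_finset (Finset.range (n + 1))).2 fun d _ => hb.2 d
  filter_upwards [hev] with i hi
  by_cases hall : ∀ d < n + 1, ⌊contFracShift^[i + d] x⌋ = b d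
  · have h1 := hclose i hall
    have h2 : |(s : ℝ) * (contFracShift^[i] x - y)| < η := by
      rw [abs_mul, ← Int.cast_abs, hs, Int.cast_one, one_mul]
      exact h1
    linarith [(abs_lt.1 h2).1]
  · classical
    push Not at hall
    -- the first partial quotient of `T^i x` that differs from `b`
    obtain ⟨hd, hne⟩ := Nat.find_spec hall
    set d := Nat.find hall
    have hlt (e : ℕ) (he : e < d) : ⌊contFracShift^[i + e] x⌋ = b e := by
      have := Nat.find_min hall he
      by_contra hne'
      exact this ⟨by omega, hne'⟩
    have h1 := hi d (Finset.mem_range.2 hd) hlt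
    have hs0 : s ≠ 0 := by rintro rfl; simp at hs
    have h2 := h1.lt_of_ne fun h => hne (mul_left_cancel₀ (by simpa using hs0) h).symm
    have h3 := lt_of_floor_lt hδ hy (hx.iterate i) s d
      (fun e he => by rw [← Function.iterate_add_apply, add_comm, hlt e he, hyb])
      (by rw [← Function.iterate_add_apply, add_comm d i, hyb]; exact h2)
    linarith

theorem finiteKernel_sign (k : ℕ) (s : ℤ) : FiniteKernel k (fun n : ℕ => s * (-1) ^ n) := by
  simpa only [← neg_one_pow_eq_pow_mod_two] using
    (FiniteKernel.mod_two (k := k)).map fun r => s * (-1) ^ r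

/-- A real number with automatic expansion has limit points with automatic expansions that are
extremal in the direction given by the sign `s`. -/
theorem exists_automatic_extremal_limit {k : ℕ} (hk : 2 ≤ k) {x : ℝ} (hx : Irrational x)
    (hauto : HasAutomaticContFrac k x) {s : ℤ} (hs : |s| = 1) :
    ∃ y, HasAutomaticContFrac k y ∧
      ∀ η > 0, (∃ᶠ i in atTop, |contFracShift^[i] x - y| < η) ∧
        ∀ᶠ i in atTop, s * y - η < s * contFracShift^[i] x := by
  obtain ⟨a, hxa, ⟨B, hB⟩, ha⟩ := hauto
  have hxa' := (hasContFracExpansion_iff hx.fract_iterate_ne_zero a).1 hxa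
  obtain rfl : (fun n => ⌊contFracShift^[n] x⌋) = a := funext hxa'
  have hB0 : (0 : ℝ) ≤ B := by exact_mod_cast (abs_nonneg _).trans (hB 0)
  have hδ : 0 < (B + 1 : ℝ)⁻¹ := by positivity
  obtain ⟨b, hb⟩ := exists_isLeastLimit (fun n => s * (-1) ^ n) hB
  obtain ⟨y, hy, hyb, hlim⟩ :=
    (fractBound_of_floor_le hx.fract_iterate_ne_zero hB).exists_extremal_limit hδ hs hb
  refine ⟨y, ⟨b, (hasContFracExpansion_iff (hy.fract_ne_zero hδ) b).2 hyb, ⟨B, fun n => ?_⟩, ?_⟩,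
    hlim⟩
  · obtain ⟨i, hi⟩ := (hb.1 (n + 1)).exists
    rw [← hi n (by omega)]
    exact hB _
  · have hs0 : s ≠ 0 := by rintro rfl; simp at hs
    rw [isAutomatic_iff_finiteKernel hk] at ha ⊢
    exact hb.finiteKernel (by omega) (fun n => by simpa using hs0) (finiteKernel_sign k s) ha

theorem theorem5 (k : ℕ) (hk : 2 ≤ k) (x : ℝ) (hx : Irrational x)
    (hauto : HasAutomaticContFrac k x) :
    Filter.IsBoundedUnder (· ≥ ·) Filter.atTop (fun n : ℕ => contFracShift^[n] x) ∧
    Filter.IsBoundedUnder (· ≤ ·) Filter.atTop (fun n : ℕ => contFracShift^[n] x) ∧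
    HasAutomaticContFrac k (Filter.liminf (fun n : ℕ => contFracShift^[n] x) Filter.atTop) ∧
    HasAutomaticContFrac k (Filter.limsup (fun n : ℕ => contFracShift^[n] x) Filter.atTop) := by
  obtain ⟨y, hy, hylim⟩ := exists_automatic_extremal_limit hk hx hauto (s := 1) (by simp)
  obtain ⟨z, hz, hzlim⟩ := exists_automatic_extremal_limit hk hx hauto (s := -1) (by simp)
  push_cast at hylim hzlim
  have hge : IsBoundedUnder (· ≥ ·) atTop (fun n : ℕ => contFracShift^[n] x) :=
    ⟨y - 1, eventually_map.2 ((hylim 1 one_pos).2.mono fun i hi => by linarith)⟩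
  have hle : IsBoundedUnder (· ≤ ·) atTop (fun n : ℕ => contFracShift^[n] x) :=
    ⟨z + 1, eventually_map.2 ((hzlim 1 one_pos).2.mono fun i hi => by linarith)⟩
  have hliminf : liminf (fun n : ℕ => contFracShift^[n] x) atTop = y := by
    refine le_antisymm (le_of_forall_pos_le_add fun η hη => ?_)
      (le_of_forall_sub_le fun η hη => ?_)
    · exact liminf_le_of_frequently_le
        ((hylim η hη).1.mono fun i hi => by linarith [(abs_lt.1 hi).2]) hge
    · exact le_liminf_of_le hle.isCoboundedUnder_ge
        ((hylim η hη).2.mono fun i hi => by linarith)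
  have hlimsup : limsup (fun n : ℕ => contFracShift^[n] x) atTop = z := by
    refine le_antisymm (le_of_forall_pos_le_add fun η hη => ?_)
      (le_of_forall_sub_le fun η hη => ?_)
    · exact limsup_le_of_le hge.isCoboundedUnder_le
        ((hzlim η hη).2.mono fun i hi => by linarith)
    · exact le_limsup_of_frequently_le
        ((hzlim η hη).1.mono fun i hi => by linarith [(abs_lt.1 hi).1]) hle
  exact ⟨hge, hle, hliminf ▸ hy, hlimsup ▸ hz⟩
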